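/- **Model.** Let $0\le s<1$ and $0<\gamma\le 1$; put $g=1/\gamma$ and $l=\max\{1-s,\gamma\}$. Finitely many nodes lie at points of the real line, any two at distance at least $\gamma$. Two nodes are linked (are neighbours) iff their distance is in $(s,1]$; the resulting graph is assumed connected, and $D$ is its (hop) diameter. Computation is synchronous. In each round each node either transmits or listens; a node $v$ receives a message iff it listens, no node within distance $s$ of $v$ transmits, and exactly one neighbour of $v$ transmits; it then receives that neighbour's message. Otherwise it perceives only background noise. Each node initially knows only $s$, $\gamma$ and its own coordinate; one node, the source, also holds a message $m$. All nodes are awake from the beginning. **Partition.** The line is cut at the multiples of $3$ into regions $[3k,3k+3)$. Each region is cut, from left to right, into $\mu=\lceil 3/l\rceil$ blocks of length $l$, and each block into $\nu=\lceil l/\gamma\rceil$ homes of length $\gamma$ (the last block of a region and the last home or homes of a block may be shorter or empty); all pieces contain their left and exclude their right end. Blocks in a region and homes in a block are numbered from left to right; the label of a node is its pair (block, home). **Algorithm $\mathcal B$** consists of Procedure $\mathcal D^*$ followed by Procedure $\mathcal T$. *Procedure $\mathcal D^*$* ($\mu\nu+(\mu\nu)^2$ rounds). First (Procedure $\mathcal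 D$), for each label $(b',h')$ in lexicographic order there is one round in which exactly the nodes labelled $(b',h')$ transmit "hello"; each node $u$ that hears a hello in that round puts $(b',h')$ into its set $N_u$, initially empty. Then, for each label $(b,h)$ and, inside that loop, for each label $(b',h')$, there is one round in which exactly the nodes labelled $(b,h)$ or $(b',h')$ transmit "hello"; each listening node $u$ that hears nothing in that round, and that heard a hello from $(b,h)$ during Procedure $\mathcal D$, adds $(b',h')$ to $N_u$. *Procedure $\mathcal T$.* In its first round the source transmits $m$. Then the following sweep of $6\mu$ rounds is repeated: for each block number $b=1,\dots,\mu$, six rounds are reserved for the blocks numbered $b$ in all regions; in these six rounds the left boundary, right boundary, left range, right range, left potential and right potential spokesmen of these blocks, in this order, transmit $m$, and all other nodes listen. Transmissions of $m$ carry the sender's coordinate. A node $u$ fixes its status at the beginning of the six rounds of its block from what it has received before. Let $O$ be the set of homes of its block that are its own or whose label lies in $N_u$, and let $R$ be the set of intervals $[p-1,p-s)$ and $(p+s,p+1]$, over the coordinates $p$ of all senders from which $u$ has received $m$. Say that $\sigma\in R$ ends right (left) if some point of the block lies to the right (left) of all of $\sigma$; a home is partially contained in $\sigma$ if it meets $\sigma$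 but is not contained in it. Then $u$ is - a right (left) boundary spokesman if its home is the rightmost (leftmost) in $O$ and is contained in some $\sigma\in R$; - a right (left) range spokesman if its home is not the rightmost (leftmost) in $O$, and it is the rightmost (leftmost) home in $O$ that is contained in some $\sigma\in R$ that ends right (left); - a right (left) potential spokesman if its home is the rightmost (leftmost) home of the block that is partially contained in some $\sigma\in R$ that ends right (left). **Theorem.** There are absolute constants $c,C>0$ such that for all $s,\gamma$, all such connected networks, every source and every message $m$: 1. the number of rounds of Procedure $\mathcal D^*$ is at least $c\,g^2$ and at most $C\,g^2$, and at its end $N_u$ is, for each node $u$, exactly the set of labels of the other nodes within distance $1$ of $u$; 2. Procedure $\mathcal T$ then informs all nodes of $m$ within $C\,D/l$ rounds; and Algorithm $\mathcal B$ informs all nodes within $C\,(D/l+g^2)$ rounds in total, i.e. it broadcasts in time $O(D/l+g^2)$. -/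

import Mathlib

namespace Highway

/-! ### The swamping radio model on the line -/

/-- Messages: a control message `hello`, or the source message together with the location of the
node that transmits it. -/
inductive Msg (M : Type*) where
  | hello : Msg M
  | data (m : M) (loc : ℝ) : Msg M

/-- What a node has perceived so far: entry `i` is what it received in round `i`
(`none` is background noise, which is also what collisions, swamping and one's own
transmissions leave). -/
abbrev History (M : Type*) := List (Option (Msg M))

/-- A deterministic distributed algorithm. From `s`, `γ`, its own location, the source message
(available at the source only) and its history, a node decides what to transmit in the next
round; `none` means that it listens. The number of the round is the length of the history. -/
abbrev Protocol (M : Type*) :=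
  (s γ x : ℝ) → (own : Option M) → (h : History M) → Option (Msg M)

/-- The network: nodes are linked iff their distance lies in `(s, 1]`. -/
def swampGraph {V : Type*} (s : ℝ) (pos : V → ℝ) : SimpleGraph V where
  Adj u v := u ≠ v ∧ s < |pos u - pos v| ∧ |pos u - pos v| ≤ 1
  symm := ⟨fun u v h => ⟨h.1.symm, by rw [abs_sub_comm]; exact h.2.1,
    by rw [abs_sub_comm]; exact h.2.2⟩⟩
  loopless := ⟨fun _ h => h.1 rfl⟩

open Classical in
/-- What `u` receives in a round in which each node `v` transmits `act v`: a message gets through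
iff `u` listens, no node within distance `s` of `u` transmits, and exactly one neighbour of `u`
transmits. -/
noncomputable def receive {V M : Type*} (s : ℝ) (pos : V → ℝ) (act : V → Option (Msg M)) (u : V) :
    Option (Msg M) :=
  if h : act u = none ∧ (∀ v, |pos u - pos v| ≤ s → act v = none) ∧
      ∃! v, (swampGraph s pos).Adj u v ∧ act v ≠ none
  then act h.2.2.choose else none

/-- The histories of all nodes after `t` rounds of the synchronous execution of `A`. -/
noncomputable def history {V M : Type*} (A : Protocol M) (s γ : ℝ) (pos : V → ℝ)
    (own : V → Option M) : ℕ → V → History M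
  | 0 => fun _ => []
  | t + 1 => fun u => history A s γ pos own t u ++
      [receive s pos (fun v => A s γ (pos v) (own v) (history A s γ pos own t v)) u]

open Classical in
/-- Only the source holds the message initially. -/
noncomputable def sourceInput {V M : Type*} (src : V) (m : M) (v : V) : Option M :=
  if v = src then some m else none

/-- After `t` rounds of `A`, started with message `m` at `src`, node `u` has the message `m`. -/
def Informed {V M : Type*} (A : Protocol M) (s γ : ℝ) (pos : V → ℝ) (src : V) (m : M)
    (t : ℕ) (u : V) : Prop :=
  u = src ∨ ∃ p, some (Msg.data m p) ∈ history A s γ pos (sourceInput src m) t u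

/-! ### The partition of the line into regions, blocks and homes (labels start at `0`) -/

/-- The length of a block. -/
noncomputable def blockLen (s γ : ℝ) : ℝ := max (1 - s) γ

/-- The number `μ` of blocks in a region. -/
noncomputable def numBlocks (s γ : ℝ) : ℕ := ⌈3 / blockLen s γ⌉₊

/-- The number `ν` of homes in a block. -/
noncomputable def numHomes (s γ : ℝ) : ℕ := ⌈blockLen s γ / γ⌉₊

/-- The number `μν` of (block, home) labels. -/
noncomputable def numLabels (s γ : ℝ) : ℕ := numBlocks s γ * numHomes s γ

/-- The left end of the region (of length `3`) that contains `x`. -/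
noncomputable def regionLeft (x : ℝ) : ℝ := 3 * (⌊x / 3⌋ : ℝ)

/-- The label, within its region, of the block that contains `x`. -/
noncomputable def blockIdx (s γ x : ℝ) : ℕ := ⌊(x - regionLeft x) / blockLen s γ⌋₊

/-- The left end of the block that contains `x`. -/
noncomputable def blockLeft (s γ x : ℝ) : ℝ := regionLeft x + blockIdx s γ x * blockLen s γ

/-- The right end of the block that contains `x` (the last block of a region may be shorter). -/
noncomputable def blockRight (s γ x : ℝ) : ℝ :=
  min (blockLeft s γ x + blockLen s γ) (regionLeft x + 3)

/-- The block that contains `x`. -/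
noncomputable def block (s γ x : ℝ) : Set ℝ := Set.Ico (blockLeft s γ x) (blockRight s γ x)

/-- The label, within its block, of the home that contains `x`. -/
noncomputable def homeIdx (s γ x : ℝ) : ℕ := ⌊(x - blockLeft s γ x) / γ⌋₊

/-- The home with label `k` in the block that contains `x` (the last one may be shorter). -/
noncomputable def home (s γ x : ℝ) (k : ℕ) : Set ℝ :=
  Set.Ico (blockLeft s γ x + k * γ) (min (blockLeft s γ x + (k + 1) * γ) (blockRight s γ x))

/-- The (block, home) label of the point `x`. -/
noncomputable def label (s γ x : ℝ) : ℕ × ℕ := (blockIdx s γ x, homeIdx s γ x)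

/-- The `i`-th label in the order of the double loop over blocks and homes. -/
noncomputable def loopLabel (s γ : ℝ) (i : ℕ) : ℕ × ℕ := (i / numHomes s γ, i % numHomes s γ)

/-! ### Procedure `D*`: neighbourhood discovery

Rounds `0, …, μν - 1` are Procedure `D`: round `i` belongs to the label `loopLabel i`.
Rounds `μν + j` with `j < (μν)²` are the Procedures `D_(b,h)`, one after the other, with
`(b,h) = loopLabel (j / μν)` and current label `loopLabel (j % μν)`. -/

/-- The number of rounds of Procedure `D*`. -/
noncomputable def dStarRounds (s γ : ℝ) : ℕ := numLabels s γ + numLabels s γ ^ 2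

/-- Whether a node at `x` transmits `hello` in round `t` of Procedure `D*`. -/
def dStarTransmits (s γ x : ℝ) (t : ℕ) : Prop :=
  (t < numLabels s γ ∧ label s γ x = loopLabel s γ t) ∨
  (numLabels s γ ≤ t ∧
    (label s γ x = loopLabel s γ ((t - numLabels s γ) / numLabels s γ) ∨
      label s γ x = loopLabel s γ ((t - numLabels s γ) % numLabels s γ)))

/-- The labels from which a `hello` was heard during Procedure `D`. -/
def heardLabels {M : Type*} (s γ : ℝ) (h : History M) : Set (ℕ × ℕ) :=
  {c | ∃ i < numLabels s γ, loopLabel s γ i = c ∧ h[i]? = some (some Msg.hello)}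

/-- The set `N_u` of labels known to a node at `x` with history `h`: those heard in Procedure `D`,
and each label whose turn in a Procedure `D_(b,h)` was silent, where the node listened and
had heard `(b,h)` in Procedure `D`. -/
def knownLabels {M : Type*} (s γ x : ℝ) (h : History M) : Set (ℕ × ℕ) :=
  heardLabels s γ h ∪
  {c | ∃ j < numLabels s γ ^ 2,
    loopLabel s γ (j % numLabels s γ) = c ∧
    loopLabel s γ (j / numLabels s γ) ∈ heardLabels s γ h ∧
    ¬ dStarTransmits s γ x (numLabels s γ + j) ∧
    h[numLabels s γ + j]? = some none}

/-! ### Spokesmen -/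

/-- The two intervals that form the communication range of a node at `p`. -/
def rangeParts (s p : ℝ) : Set (Set ℝ) :=
  {Set.Ico (p - 1) (p - s), Set.Ioc (p + s) (p + 1)}

/-- The parts of the ranges of all senders from which the source message was received in a round
before round `t`. -/
def heardRanges {M : Type*} (s : ℝ) (h : History M) (t : ℕ) : Set (Set ℝ) :=
  {σ | ∃ i < t, ∃ m p, h[i]? = some (some (Msg.data m p)) ∧ σ ∈ rangeParts s p}

/-- The homes of its own block that a node at `x` with history `h` knows to be occupied. -/
def occupied {M : Type*} (s γ x : ℝ) (h : History M) : Set ℕ :=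
  {k | k = homeIdx s γ x ∨ (blockIdx s γ x, k) ∈ knownLabels s γ x h}

/-- `σ` ends inside the block of `x` on the right: some point of the block is right of `σ`. -/
def EndsRight (s γ x : ℝ) (σ : Set ℝ) : Prop := ∃ y ∈ block s γ x, ∀ z ∈ σ, z < y

/-- `σ` ends inside the block of `x` on the left: some point of the block is left of `σ`. -/
def EndsLeft (s γ x : ℝ) (σ : Set ℝ) : Prop := ∃ y ∈ block s γ x, ∀ z ∈ σ, y < z

/-- The home `k` in the block of `x` is partially contained in `σ`. -/
def Partial (s γ x : ℝ) (k : ℕ) (σ : Set ℝ) : Prop :=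
  (home s γ x k ∩ σ).Nonempty ∧ ¬ home s γ x k ⊆ σ

/-- The six kinds of spokesmen, in the order in which they transmit. -/
inductive Kind where
  | leftBoundary | rightBoundary | leftRange | rightRange | leftPotential | rightPotential

/-- Whether a node at `x` with known occupied homes `O` in its block is a spokesman of a given
kind, where `R` are the parts of sender ranges known to it. -/
def IsSpokesman (s γ x : ℝ) (O : Set ℕ) (R : Set (Set ℝ)) : Kind → Prop
  | .leftBoundary =>
      (∃ σ ∈ R, home s γ x (homeIdx s γ x) ⊆ σ) ∧ ∀ k ∈ O, homeIdx s γ x ≤ k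
  | .rightBoundary =>
      (∃ σ ∈ R, home s γ x (homeIdx s γ x) ⊆ σ) ∧ ∀ k ∈ O, k ≤ homeIdx s γ x
  | .leftRange =>
      (∃ σ ∈ R, EndsLeft s γ x σ ∧ home s γ x (homeIdx s γ x) ⊆ σ) ∧
      (∀ k ∈ O, k < homeIdx s γ x → ∀ σ ∈ R, EndsLeft s γ x σ → ¬ home s γ x k ⊆ σ) ∧
      ∃ k ∈ O, k < homeIdx s γ x
  | .rightRange =>
      (∃ σ ∈ R, EndsRight s γ x σ ∧ home s γ x (homeIdx s γ x) ⊆ σ) ∧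
      (∀ k ∈ O, homeIdx s γ x < k → ∀ σ ∈ R, EndsRight s γ x σ → ¬ home s γ x k ⊆ σ) ∧
      ∃ k ∈ O, homeIdx s γ x < k
  | .leftPotential =>
      (∃ σ ∈ R, EndsLeft s γ x σ ∧ Partial s γ x (homeIdx s γ x) σ) ∧
      ∀ k < homeIdx s γ x, ∀ σ ∈ R, EndsLeft s γ x σ → ¬ Partial s γ x k σ
  | .rightPotential =>
      (∃ σ ∈ R, EndsRight s γ x σ ∧ Partial s γ x (homeIdx s γ x) σ) ∧
      ∀ k > homeIdx s γ x, ∀ σ ∈ R, EndsRight s γ x σ → ¬ Partial s γ x k σ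

/-! ### Procedure `T` and Algorithm `B` -/

/-- The kind of spokesman that transmits in round `i` of the six rounds of a block. -/
def kindOf : ℕ → Kind
  | 0 => .leftBoundary
  | 1 => .rightBoundary
  | 2 => .leftRange
  | 3 => .rightRange
  | 4 => .leftPotential
  | _ => .rightPotential

/-- The source message, as far as a node knows it. -/
def knownMessage {M : Type*} (own : Option M) (h : History M) : Option M :=
  own <|> h.findSome? fun r =>
    match r with
    | some (Msg.data m _) => some m
    | _ => none

/-- In round `1 + i` of Procedure `T` the nodes of the blocks with label `(i % 6μ) / 6` are in
turn, and among them the spokesmen of kind `kindOf (i % 6)`. The status of a node depends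
on the source messages it received before the six rounds of its block began. -/
def tTransmits {M : Type*} (s γ x : ℝ) (h : History M) (i : ℕ) : Prop :=
  blockIdx s γ x = (i % (6 * numBlocks s γ)) / 6 ∧
  IsSpokesman s γ x (occupied s γ x h)
    (heardRanges s h (dStarRounds s γ + 1 + (i - i % 6))) (kindOf (i % 6))

open Classical in
/-- Algorithm `B`: Procedure `D*`, followed by Procedure `T`, in which first the source transmits
the message once, and then the loop over all blocks is repeated. -/
noncomputable def algorithmB (M : Type*) : Protocol M := fun s γ x own h =>
  if h.length < dStarRounds s γ then
    (if dStarTransmits s γ x h.length then some Msg.hello else none)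
  else if h.length = dStarRounds s γ then
    own.map fun m => Msg.data m x
  else if tTransmits s γ x h (h.length - (dStarRounds s γ + 1)) then
    (knownMessage own h).map fun m => Msg.data m x
  else none

end Highway

namespace Highway

/-!
A block is at most as long as either part of a node's communication range, or else it consists of a
single home. Hence a range part that ends inside a block on some side contains everything on the
other side of any of its points. This makes the spokesman of each kind unique in its block, so no
two nodes within distance `2` ever transmit together and every transmission of the source message
reaches all neighbours of the sender. Then all nodes of a range part learn of it at the same moment,
which in turn is what the uniqueness argument needs: an induction on the round closes the circle.

A node `u` that has the message lies between two spokesmen of its block. These are less than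
`1 - s` apart, so every neighbour of `u` is a neighbour of one of them. Thus each sweep of
`6μ = O(1 / l)` rounds advances the message by one hop.
-/

/-! ### Geometry of the partition -/

section Geometry

lemma mem_Ico_floor_div {a d x : ℝ} (hd : 0 < d) (hax : a ≤ x) :
    x ∈ Set.Ico (a + ⌊(x - a) / d⌋₊ * d) (a + (⌊(x - a) / d⌋₊ + 1) * d) := by
  have hle := Nat.floor_le (div_nonneg (sub_nonneg.2 hax) hd.le)
  have hlt := Nat.lt_floor_add_one ((x - a) / d)
  rw [le_div_iff₀ hd] at hle
  rw [div_lt_iff₀ hd] at hlt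
  exact ⟨by linarith, by linarith⟩

lemma floor_div_lt_ceil_div {a d x L : ℝ} (hd : 0 < d) (hx : x ∈ Set.Ico a (a + L)) :
    ⌊(x - a) / d⌋₊ < ⌈L / d⌉₊ := by
  rw [Nat.lt_ceil]
  refine (Nat.floor_le (div_nonneg (sub_nonneg.2 hx.1) hd.le)).trans_lt ?_
  gcongr
  linarith [hx.2]

lemma mem_Ico_regionLeft (x : ℝ) : x ∈ Set.Ico (regionLeft x) (regionLeft x + 3) := by
  have hle := Int.floor_le (x / 3)
  have hlt := Int.lt_floor_add_one (x / 3)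
  unfold regionLeft
  exact ⟨by linarith, by linarith⟩

lemma regionLeft_eq_of_abs_sub_lt {x y : ℝ} (h : |regionLeft x - regionLeft y| < 3) :
    regionLeft x = regionLeft y := by
  unfold regionLeft at h ⊢
  rw [← mul_sub, abs_mul, abs_of_pos three_pos, mul_lt_iff_lt_one_right three_pos] at h
  have hfloor : |⌊x / 3⌋ - ⌊y / 3⌋| < 1 := by exact_mod_cast h
  rw [sub_eq_zero.1 (Int.abs_lt_one_iff.1 hfloor)]

variable {s γ : ℝ}

lemma blockLen_pos (hγ : 0 < γ) : 0 < blockLen s γ := lt_max_of_lt_right hγ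

lemma blockLen_le_one (hs : 0 ≤ s) (hγ1 : γ ≤ 1) : blockLen s γ ≤ 1 :=
  max_le (by linarith) hγ1

lemma mem_Ico_blockLeft (hγ : 0 < γ) (x : ℝ) :
    x ∈ Set.Ico (blockLeft s γ x) (blockLeft s γ x + blockLen s γ) := by
  have h := mem_Ico_floor_div (blockLen_pos (s := s) hγ) (mem_Ico_regionLeft x).1
  rwa [add_one_mul, ← add_assoc] at h

lemma mem_block (hγ : 0 < γ) (x : ℝ) : x ∈ block s γ x :=
  ⟨(mem_Ico_blockLeft hγ x).1, lt_min (mem_Ico_blockLeft hγ x).2 (mem_Ico_regionLeft x).2⟩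

lemma mem_home (hγ : 0 < γ) (x : ℝ) : x ∈ home s γ x (homeIdx s γ x) :=
  have h := mem_Ico_floor_div hγ (mem_Ico_blockLeft (s := s) hγ x).1
  ⟨h.1, lt_min h.2 (mem_block hγ x).2⟩

lemma blockIdx_lt (hγ : 0 < γ) (x : ℝ) : blockIdx s γ x < numBlocks s γ :=
  floor_div_lt_ceil_div (blockLen_pos hγ) (mem_Ico_regionLeft x)

lemma homeIdx_lt (hγ : 0 < γ) (x : ℝ) : homeIdx s γ x < numHomes s γ :=
  floor_div_lt_ceil_div hγ (mem_Ico_blockLeft hγ x)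

lemma home_subset_block (hγ : 0 ≤ γ) (x : ℝ) (k : ℕ) : home s γ x k ⊆ block s γ x :=
  Set.Ico_subset_Ico (le_add_of_nonneg_right (by positivity)) (min_le_right _ _)

lemma abs_sub_lt_of_mem_block {x y z : ℝ} (hy : y ∈ block s γ x) (hz : z ∈ block s γ x) :
    |y - z| < blockLen s γ := by
  have hy' := hy.2.trans_le (min_le_left _ _)
  have hz' := hz.2.trans_le (min_le_left _ _)
  exact abs_sub_lt_iff.2 ⟨by linarith [hz.1], by linarith [hy.1]⟩

lemma abs_sub_lt_of_mem_home {x y z : ℝ} {k : ℕ} (hy : y ∈ home s γ x k) (hz : z ∈ home s γ x k) :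
    |y - z| < γ := by
  have hy' := hy.2.trans_le (min_le_left _ _)
  have hz' := hz.2.trans_le (min_le_left _ _)
  exact abs_sub_lt_iff.2 ⟨by linarith [hz.1], by linarith [hy.1]⟩

lemma lt_of_mem_home_of_lt (hγ : 0 ≤ γ) {x y z : ℝ} {j k : ℕ} (hjk : j < k)
    (hy : y ∈ home s γ x j) (hz : z ∈ home s γ x k) : y < z :=
  have hle : ((j : ℝ) + 1) * γ ≤ k * γ := by
    gcongr
    exact_mod_cast hjk
  calc y < blockLeft s γ x + (j + 1) * γ := hy.2.trans_le (min_le_left _ _)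
    _ ≤ blockLeft s γ x + k * γ := by gcongr
    _ ≤ z := hz.1

lemma eq_zero_of_mem_home (hγ : 0 < γ) (h : 1 - s ≤ γ) {x y : ℝ} {k : ℕ}
    (hy : y ∈ home s γ x k) : k = 0 := by
  have hlt := (home_subset_block hγ.le x k hy).2.trans_le (min_le_left _ _)
  rw [blockLen, max_eq_right h] at hlt
  have hk : (k : ℝ) * γ < 1 * γ := by linarith [hy.1]
  exact Nat.lt_one_iff.1 (by exact_mod_cast lt_of_mul_lt_mul_right hk hγ.le)

/-- The points `x` and `y` lie in the same block of the same region. -/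
def SameBlock (s γ x y : ℝ) : Prop :=
  regionLeft x = regionLeft y ∧ blockIdx s γ x = blockIdx s γ y

namespace SameBlock

variable {x y z : ℝ}

lemma refl (s γ x : ℝ) : SameBlock s γ x x := ⟨rfl, rfl⟩

lemma symm (h : SameBlock s γ x y) : SameBlock s γ y x := ⟨h.1.symm, h.2.symm⟩

lemma trans (h : SameBlock s γ x y) (h' : SameBlock s γ y z) : SameBlock s γ x z :=
  ⟨h.1.trans h'.1, h.2.trans h'.2⟩

lemma blockLeft_eq (h : SameBlock s γ x y) : blockLeft s γ x = blockLeft s γ y := by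
  simp only [blockLeft, h.1, h.2]

lemma block_eq (h : SameBlock s γ x y) : block s γ x = block s γ y := by
  simp only [block, blockRight, h.blockLeft_eq, h.1]

lemma home_eq (h : SameBlock s γ x y) : home s γ x = home s γ y := by
  funext k
  simp only [home, blockRight, h.blockLeft_eq, h.1]

lemma mem_home (hγ : 0 < γ) (h : SameBlock s γ x y) : x ∈ home s γ y (homeIdx s γ x) :=
  h.home_eq ▸ Highway.mem_home hγ x

lemma abs_sub_lt (hγ : 0 < γ) (h : SameBlock s γ x y) : |x - y| < blockLen s γ :=
  abs_sub_lt_of_mem_block (h.block_eq ▸ mem_block hγ x) (mem_block hγ y)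

end SameBlock

lemma sameBlock_of_abs_sub_le_two (hs : 0 ≤ s) (hγ : 0 < γ) (hγ1 : γ ≤ 1) {x y : ℝ}
    (hb : blockIdx s γ x = blockIdx s γ y) (hxy : |x - y| ≤ 2) : SameBlock s γ x y := by
  refine ⟨regionLeft_eq_of_abs_sub_lt ?_, hb⟩
  have hregion : regionLeft x - regionLeft y = blockLeft s γ x - blockLeft s γ y := by
    simp only [blockLeft, hb, add_sub_add_right_eq_sub]
  have hl := blockLen_le_one hs hγ1
  obtain ⟨hx, hx'⟩ := mem_Ico_blockLeft (s := s) hγ x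
  obtain ⟨hy, hy'⟩ := mem_Ico_blockLeft (s := s) hγ y
  obtain ⟨h, h'⟩ := abs_sub_le_iff.1 hxy
  rw [hregion, abs_sub_lt_iff]
  exact ⟨by linarith, by linarith⟩

end Geometry

/-! ### Range parts and the sides of a block -/

/-- One of the two sides of a block. Left and right spokesmen follow mirrored rules; a side as
parameter treats both at once. -/
inductive Side where
  | left | right

namespace Side

section Order

variable {α : Type*}

/-- `a` lies strictly further towards the side than `b`. Used for points of the line and for the
numbers of homes. -/
def Beyond [LT α] : Side → α → α → Prop
  | left, a, b => a < b
  | right, a, b => b < a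

lemma not_beyond_self [Preorder α] (d : Side) (a : α) : ¬ d.Beyond a a := by
  cases d <;> exact lt_irrefl a

lemma Beyond.not_beyond [Preorder α] {d : Side} {a b : α} (h : d.Beyond a b) : ¬ d.Beyond b a := by
  cases d <;> exact lt_asymm h

lemma eq_of_not_beyond [LinearOrder α] {d : Side} {a b : α} (h : ¬ d.Beyond a b)
    (h' : ¬ d.Beyond b a) : a = b := by
  cases d
  · exact le_antisymm (not_lt.1 h') (not_lt.1 h)
  · exact le_antisymm (not_lt.1 h) (not_lt.1 h')

lemma exists_extreme [LinearOrder α] (d : Side) {K : Set α} (hK : K.Finite) (hne : K.Nonempty) :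
    ∃ k ∈ K, ∀ j ∈ K, ¬ d.Beyond j k := by
  cases d
  · obtain ⟨k, hk, hmin⟩ := K.exists_min_image id hK hne
    exact ⟨k, hk, fun j hj => not_lt.2 (hmin j hj)⟩
  · obtain ⟨k, hk, hmax⟩ := K.exists_max_image id hK hne
    exact ⟨k, hk, fun j hj => not_lt.2 (hmax j hj)⟩

lemma beyond_of_notMem [LinearOrder α] {d : Side} {σ : Set α} (hσ : σ.OrdConnected) {y z w : α}
    (hy : y ∉ σ) (hz : z ∈ σ) (hyz : d.Beyond y z) (hw : w ∈ σ) : d.Beyond y w := by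
  by_contra hwy
  cases d
  · exact hy (hσ.out hw hz ⟨not_lt.1 hwy, le_of_lt hyz⟩)
  · exact hy (hσ.out hz hw ⟨le_of_lt hyz, not_lt.1 hwy⟩)

end Order

lemma mem_of_beyond {d : Side} {a b : ℝ} {σ : Set ℝ} (hIoo : Set.Ioo a b ⊆ σ)
    (hIcc : σ ⊆ Set.Icc a b) {y z w : ℝ} (hy : ∀ z ∈ σ, d.Beyond y z) (hz : z ∈ σ)
    (hzw : d.Beyond z w) (hyw : |y - w| < b - a) : w ∈ σ := by
  have hyσ : y ∉ σ := fun h => d.not_beyond_self y (hy y h)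
  have hyz := hy z hz
  obtain ⟨haz, hzb⟩ := hIcc hz
  obtain ⟨hyw, hwy⟩ := abs_sub_lt_iff.1 hyw
  cases d <;> simp only [Beyond] at hzw hyz
  · have hya : y ≤ a := not_lt.1 fun h => hyσ (hIoo ⟨h, by linarith⟩)
    exact hIoo ⟨by linarith, by linarith⟩
  · have hby : b ≤ y := not_lt.1 fun h => hyσ (hIoo ⟨by linarith, h⟩)
    exact hIoo ⟨by linarith, by linarith⟩

/-- `σ` ends inside the block of `x` on the given side; see `EndsLeft` and `EndsRight`. -/
def Ends (d : Side) (s γ x : ℝ) (σ : Set ℝ) : Prop := ∃ y ∈ block s γ x, ∀ z ∈ σ, d.Beyond y z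

lemma ends_congr {d : Side} {s γ x y : ℝ} {σ : Set ℝ} (h : SameBlock s γ x y) :
    d.Ends s γ x σ ↔ d.Ends s γ y σ := by
  rw [Ends, Ends, h.block_eq]

lemma beyond_of_mem_home {d : Side} {s γ x y z : ℝ} {j k : ℕ} (hγ : 0 ≤ γ) (hjk : d.Beyond j k)
    (hy : y ∈ home s γ x j) (hz : z ∈ home s γ x k) : d.Beyond y z := by
  cases d
  · exact lt_of_mem_home_of_lt hγ hjk hy hz
  · exact lt_of_mem_home_of_lt hγ hjk hz hy

end Side

section RangeParts

variable {s γ x p : ℝ} {σ : Set ℝ} {d : Side} {j k : ℕ}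

lemma ordConnected_of_mem_rangeParts (hσ : σ ∈ rangeParts s p) : σ.OrdConnected := by
  rcases hσ with rfl | rfl
  · exact Set.ordConnected_Ico
  · exact Set.ordConnected_Ioc

lemma exists_Ioo_subset_subset_Icc_of_mem_rangeParts (hσ : σ ∈ rangeParts s p) :
    ∃ a b, b - a = 1 - s ∧ Set.Ioo a b ⊆ σ ∧ σ ⊆ Set.Icc a b := by
  rcases hσ with rfl | rfl
  · exact ⟨_, _, by ring, Set.Ioo_subset_Ico_self, Set.Ico_subset_Icc_self⟩
  · exact ⟨_, _, by ring, Set.Ioo_subset_Ioc_self, Set.Ioc_subset_Icc_self⟩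

lemma exists_mem_rangeParts_iff (hs : 0 ≤ s) :
    (∃ σ ∈ rangeParts s p, x ∈ σ) ↔ s < |x - p| ∧ |x - p| ≤ 1 := by
  simp only [rangeParts, Set.mem_insert_iff, Set.mem_singleton_iff, exists_eq_or_imp,
    exists_eq_left, Set.mem_Ico, Set.mem_Ioc, lt_abs, abs_le]
  constructor
  · rintro (⟨h, h'⟩ | ⟨h, h'⟩)
    · exact ⟨Or.inr (by linarith), by linarith, by linarith⟩
    · exact ⟨Or.inl (by linarith), by linarith, by linarith⟩
  · rintro ⟨h | h, h', h''⟩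
    · exact Or.inr ⟨by linarith, by linarith⟩
    · exact Or.inl ⟨by linarith, by linarith⟩

lemma ends_of_notMem (hσ : σ ∈ rangeParts s p) {y z : ℝ} (hy : y ∈ block s γ x) (hyσ : y ∉ σ)
    (hz : z ∈ σ) (hyz : d.Beyond y z) : d.Ends s γ x σ :=
  ⟨y, hy, fun _ => Side.beyond_of_notMem (ordConnected_of_mem_rangeParts hσ) hyσ hz hyz⟩

lemma exists_ends_of_notMem (hσ : σ ∈ rangeParts s p) {y z : ℝ} (hy : y ∈ block s γ x)
    (hyσ : y ∉ σ) (hz : z ∈ σ) : ∃ d : Side, d.Ends s γ x σ := by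
  rcases lt_or_gt_of_ne (ne_of_mem_of_not_mem hz hyσ) with hzy | hyz
  · exact ⟨.right, ends_of_notMem hσ hy hyσ hz hzy⟩
  · exact ⟨.left, ends_of_notMem hσ hy hyσ hz hyz⟩

lemma home_subset_of_ends (hγ : 0 < γ) (hσ : σ ∈ rangeParts s p) (hE : d.Ends s γ x σ)
    (hjk : d.Beyond j k) (hj : (home s γ x j ∩ σ).Nonempty) : home s γ x k ⊆ σ := by
  obtain ⟨y, hy, hyσ⟩ := hE
  obtain ⟨z, hz, hzσ⟩ := hj
  intro w hw
  rcases le_total γ (1 - s) with h | h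
  · obtain ⟨a, b, hab, hIoo, hIcc⟩ := exists_Ioo_subset_subset_Icc_of_mem_rangeParts hσ
    refine Side.mem_of_beyond hIoo hIcc hyσ hzσ (Side.beyond_of_mem_home hγ.le hjk hz hw) ?_
    calc |y - w| < blockLen s γ := abs_sub_lt_of_mem_block hy (home_subset_block hγ.le x k hw)
      _ = 1 - s := max_eq_left h
      _ = b - a := hab.symm
  · rw [eq_zero_of_mem_home hγ h hz, eq_zero_of_mem_home hγ h hw] at hjk
    exact absurd hjk (d.not_beyond_self 0)

lemma home_subset_of_not_ends (hγ : 0 ≤ γ) (hσ : σ ∈ rangeParts s p) (hE : ¬ d.Ends s γ x σ)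
    (hjk : d.Beyond j k) (hk : (home s γ x k ∩ σ).Nonempty) : home s γ x j ⊆ σ := by
  obtain ⟨z, hz, hzσ⟩ := hk
  intro y hy
  by_contra hyσ
  exact hE (ends_of_notMem hσ (home_subset_block hγ x j hy) hyσ hzσ
    (Side.beyond_of_mem_home hγ hjk hy hz))

end RangeParts

/-! ### Spokesmen -/

namespace Side

/-- The boundary spokesmen on the given side. -/
def boundary : Side → Kind
  | left => .leftBoundary
  | right => .rightBoundary

/-- The range spokesmen on the given side. -/
def range : Side → Kind
  | left => .leftRange
  | right => .rightRange

/-- The potential spokesmen on the given side. -/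
def potential : Side → Kind
  | left => .leftPotential
  | right => .rightPotential

lemma exists_eq_kind (κ : Kind) : ∃ d : Side, κ = d.boundary ∨ κ = d.range ∨ κ = d.potential := by
  cases κ
  exacts [⟨left, .inl rfl⟩, ⟨right, .inl rfl⟩, ⟨left, .inr (.inl rfl)⟩, ⟨right, .inr (.inl rfl)⟩,
    ⟨left, .inr (.inr rfl)⟩, ⟨right, .inr (.inr rfl)⟩]

end Side

section IsSpokesman

variable {s γ x : ℝ} {O : Set ℕ} {R : Set (Set ℝ)} {d : Side}

lemma isSpokesman_boundary_iff : IsSpokesman s γ x O R d.boundary ↔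
    (∃ σ ∈ R, home s γ x (homeIdx s γ x) ⊆ σ) ∧ ∀ k ∈ O, ¬ d.Beyond k (homeIdx s γ x) := by
  cases d <;> simp only [Side.boundary, IsSpokesman, Side.Beyond, not_lt]

lemma isSpokesman_range_iff : IsSpokesman s γ x O R d.range ↔
    (∃ σ ∈ R, d.Ends s γ x σ ∧ home s γ x (homeIdx s γ x) ⊆ σ) ∧
    (∀ k ∈ O, d.Beyond k (homeIdx s γ x) → ∀ σ ∈ R, d.Ends s γ x σ → ¬ home s γ x k ⊆ σ) ∧
    ∃ k ∈ O, d.Beyond k (homeIdx s γ x) := by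
  cases d <;> rfl

lemma isSpokesman_potential_iff : IsSpokesman s γ x O R d.potential ↔
    (∃ σ ∈ R, d.Ends s γ x σ ∧ Partial s γ x (homeIdx s γ x) σ) ∧
    ∀ k, d.Beyond k (homeIdx s γ x) → ∀ σ ∈ R, d.Ends s γ x σ → ¬ Partial s γ x k σ := by
  cases d <;> rfl

end IsSpokesman

section Speaks

variable {V : Type*} {s γ : ℝ} {pos : V → ℝ} {R : V → Set (Set ℝ)} {κ : Kind} {d : Side}
  {u v w : V}

/-- The homes of the block of `x` that contain a node. -/
def occupiedHomes (s γ : ℝ) (pos : V → ℝ) (x : ℝ) : Set ℕ :=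
  {k | ∃ v, SameBlock s γ (pos v) x ∧ homeIdx s γ (pos v) = k}

/-- `R u` is a set of range parts that is shared by all nodes lying in them, as are the parts of the
ranges of all senders from which `u` has received the message so far. -/
structure IsRangeFamily (s : ℝ) (pos : V → ℝ) (R : V → Set (Set ℝ)) : Prop where
  exists_mem_rangeParts : ∀ {u σ}, σ ∈ R u → ∃ p, σ ∈ rangeParts s p
  mem_of_mem : ∀ {u v σ}, σ ∈ R u → pos v ∈ σ → σ ∈ R v

/-- The node `v` is a spokesman of kind `κ` of its block when it knows exactly which homes of the
block are occupied, and the range parts `R v`. -/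
def Speaks (s γ : ℝ) (pos : V → ℝ) (R : V → Set (Set ℝ)) (κ : Kind) (v : V) : Prop :=
  IsSpokesman s γ (pos v) (occupiedHomes s γ pos (pos v)) (R v) κ

lemma eq_of_homeIdx_eq (hγ : 0 < γ) (hsep : ∀ u v, u ≠ v → γ ≤ |pos u - pos v|)
    (hvw : SameBlock s γ (pos v) (pos w)) (h : homeIdx s γ (pos v) = homeIdx s γ (pos w)) :
    v = w := by
  by_contra hne
  exact (hsep v w hne).not_gt
    (abs_sub_lt_of_mem_home (h ▸ hvw.mem_home hγ) (mem_home hγ (pos w)))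

lemma not_beyond_of_speaks_boundary (hw : Speaks s γ pos R d.boundary w)
    (hvw : SameBlock s γ (pos v) (pos w)) :
    ¬ d.Beyond (homeIdx s γ (pos v)) (homeIdx s γ (pos w)) :=
  (isSpokesman_boundary_iff.1 hw).2 _ ⟨v, hvw, rfl⟩

lemma not_beyond_of_speaks_range (hγ : 0 < γ) (hR : IsRangeFamily s pos R)
    (hv : Speaks s γ pos R d.range v) (hw : Speaks s γ pos R d.range w)
    (hvw : SameBlock s γ (pos v) (pos w)) :
    ¬ d.Beyond (homeIdx s γ (pos v)) (homeIdx s γ (pos w)) := by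
  intro hlt
  obtain ⟨⟨σ, hσ, hE, hsub⟩, -, -⟩ := isSpokesman_range_iff.1 hv
  obtain ⟨-, hextreme, -⟩ := isSpokesman_range_iff.1 hw
  obtain ⟨p, hσp⟩ := hR.exists_mem_rangeParts hσ
  rw [Side.ends_congr hvw] at hE
  rw [hvw.home_eq] at hsub
  have hwσ : pos w ∈ σ := home_subset_of_ends hγ hσp hE hlt
    ⟨pos v, hvw.mem_home hγ, hsub (hvw.mem_home hγ)⟩ (mem_home hγ (pos w))
  exact hextreme _ ⟨v, hvw, rfl⟩ hlt σ (hR.mem_of_mem hσ hwσ) hE hsub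

lemma not_beyond_of_speaks_potential (hγ : 0 < γ) (hR : IsRangeFamily s pos R)
    (hv : Speaks s γ pos R d.potential v) (hw : Speaks s γ pos R d.potential w)
    (hvw : SameBlock s γ (pos v) (pos w)) :
    ¬ d.Beyond (homeIdx s γ (pos v)) (homeIdx s γ (pos w)) := by
  intro hlt
  obtain ⟨⟨σ, hσ, hE, hpartial⟩, -⟩ := isSpokesman_potential_iff.1 hv
  obtain ⟨p, hσp⟩ := hR.exists_mem_rangeParts hσ
  rw [Side.ends_congr hvw] at hE
  rw [Partial, hvw.home_eq] at hpartial
  have hwσ : pos w ∈ σ := home_subset_of_ends hγ hσp hE hlt hpartial.1 (mem_home hγ (pos w))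
  exact (isSpokesman_potential_iff.1 hw).2 _ hlt σ (hR.mem_of_mem hσ hwσ) hE hpartial

lemma eq_of_speaks (hγ : 0 < γ) (hsep : ∀ u v, u ≠ v → γ ≤ |pos u - pos v|)
    (hR : IsRangeFamily s pos R) (hv : Speaks s γ pos R κ v) (hw : Speaks s γ pos R κ w)
    (hvw : SameBlock s γ (pos v) (pos w)) : v = w := by
  refine eq_of_homeIdx_eq hγ hsep hvw ?_
  obtain ⟨d, rfl | rfl | rfl⟩ := Side.exists_eq_kind κ
  · exact Side.eq_of_not_beyond (not_beyond_of_speaks_boundary hw hvw)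
      (not_beyond_of_speaks_boundary hv hvw.symm)
  · exact Side.eq_of_not_beyond (not_beyond_of_speaks_range hγ hR hv hw hvw)
      (not_beyond_of_speaks_range hγ hR hw hv hvw.symm)
  · exact Side.eq_of_not_beyond (not_beyond_of_speaks_potential hγ hR hv hw hvw)
      (not_beyond_of_speaks_potential hγ hR hw hv hvw.symm)

lemma exists_extreme_node (hγ : 0 < γ) (d : Side) {P : V → Prop} (hu : P u) :
    ∃ v, SameBlock s γ (pos v) (pos u) ∧ P v ∧ ∀ w, SameBlock s γ (pos w) (pos u) → P w →
      ¬ d.Beyond (homeIdx s γ (pos w)) (homeIdx s γ (pos v)) := by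
  set K : Set ℕ := {k | ∃ v, SameBlock s γ (pos v) (pos u) ∧ P v ∧ homeIdx s γ (pos v) = k}
  have hK : K.Finite := (Set.finite_Iio (numHomes s γ)).subset <| by
    rintro _ ⟨v, -, -, rfl⟩
    exact homeIdx_lt hγ (pos v)
  obtain ⟨_, ⟨v, hvu, hv, rfl⟩, hextreme⟩ :=
    d.exists_extreme hK ⟨_, u, SameBlock.refl s γ (pos u), hu, rfl⟩
  exact ⟨v, hvu, hv, fun w hwu hw => hextreme _ ⟨w, hwu, hw, rfl⟩⟩

lemma not_beyond_of_not_beyond_homeIdx (hγ : 0 < γ)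
    (hsep : ∀ u v, u ≠ v → γ ≤ |pos u - pos v|) (hvu : SameBlock s γ (pos v) (pos u))
    (h : ¬ d.Beyond (homeIdx s γ (pos u)) (homeIdx s γ (pos v))) :
    ¬ d.Beyond (pos u) (pos v) := by
  intro huv
  by_cases h' : d.Beyond (homeIdx s γ (pos v)) (homeIdx s γ (pos u))
  · exact huv.not_beyond (Side.beyond_of_mem_home hγ.le h' (hvu.mem_home hγ) (mem_home hγ (pos u)))
  · rw [eq_of_homeIdx_eq hγ hsep hvu (Side.eq_of_not_beyond h' h)] at huv
    exact d.not_beyond_self _ huv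

lemma exists_speaks_of_ends (hγ : 0 < γ) (hR : IsRangeFamily s pos R) {σ : Set ℝ} (hσ : σ ∈ R u)
    (hE : d.Ends s γ (pos u) σ) (hsub : home s γ (pos u) (homeIdx s γ (pos u)) ⊆ σ) :
    ∃ v, SameBlock s γ (pos v) (pos u) ∧
      ¬ d.Beyond (homeIdx s γ (pos u)) (homeIdx s γ (pos v)) ∧ ∃ κ, Speaks s γ pos R κ v := by
  obtain ⟨v, hvu, hv, hextreme⟩ := exists_extreme_node hγ d
    (P := fun v => ∃ σ ∈ R v, d.Ends s γ (pos v) σ ∧ home s γ (pos v) (homeIdx s γ (pos v)) ⊆ σ)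
    ⟨σ, hσ, hE, hsub⟩
  refine ⟨v, hvu, hextreme u (.refl s γ (pos u)) ⟨σ, hσ, hE, hsub⟩, ?_⟩
  by_cases hbeyond : ∃ k ∈ occupiedHomes s γ pos (pos v), d.Beyond k (homeIdx s γ (pos v))
  · refine ⟨d.range, isSpokesman_range_iff.2 ⟨hv, ?_, hbeyond⟩⟩
    rintro _ ⟨w, hw, rfl⟩ hwv τ hτ hEτ hsubτ
    exact hextreme w (hw.trans hvu) ⟨τ, hR.mem_of_mem hτ (hsubτ (hw.mem_home hγ)),
      (Side.ends_congr hw).2 hEτ, hw.home_eq ▸ hsubτ⟩ hwv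
  · obtain ⟨τ, hτ, -, hsubτ⟩ := hv
    exact ⟨d.boundary, isSpokesman_boundary_iff.2
      ⟨⟨τ, hτ, hsubτ⟩, fun k hk hkv => hbeyond ⟨k, hk, hkv⟩⟩⟩

lemma exists_speaks_of_not_ends (hγ : 0 < γ) (hR : IsRangeFamily s pos R) {σ : Set ℝ}
    (hσ : σ ∈ R u) (hE : ¬ d.Ends s γ (pos u) σ)
    (hsub : home s γ (pos u) (homeIdx s γ (pos u)) ⊆ σ) :
    ∃ v, SameBlock s γ (pos v) (pos u) ∧
      ¬ d.Beyond (homeIdx s γ (pos u)) (homeIdx s γ (pos v)) ∧ ∃ κ, Speaks s γ pos R κ v := by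
  obtain ⟨v, hvu, -, hextreme⟩ := exists_extreme_node (s := s) (pos := pos) (u := u) hγ d
    (P := fun _ => True) trivial
  have huv := hextreme u (.refl s γ (pos u)) trivial
  refine ⟨v, hvu, huv, d.boundary, isSpokesman_boundary_iff.2 ⟨⟨σ, ?_⟩, ?_⟩⟩
  · have hsubv : home s γ (pos u) (homeIdx s γ (pos v)) ⊆ σ := by
      by_cases hlt : d.Beyond (homeIdx s γ (pos v)) (homeIdx s γ (pos u))
      · obtain ⟨p, hσp⟩ := hR.exists_mem_rangeParts hσ
        exact home_subset_of_not_ends hγ.le hσp hE hlt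
          ⟨pos u, mem_home hγ (pos u), hsub (mem_home hγ (pos u))⟩
      · rwa [Side.eq_of_not_beyond hlt huv]
    exact ⟨hR.mem_of_mem hσ (hsubv (hvu.mem_home hγ)), hvu.home_eq ▸ hsubv⟩
  · rintro _ ⟨w, hw, rfl⟩
    exact hextreme w (hw.trans hvu) trivial

lemma exists_speaks_potential (hγ : 0 < γ) (hR : IsRangeFamily s pos R) {σ : Set ℝ}
    (hσ : σ ∈ R u) (hu : pos u ∈ σ)
    (hsub : ∀ τ ∈ R u, ¬ home s γ (pos u) (homeIdx s γ (pos u)) ⊆ τ) :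
    ∃ d : Side, Speaks s γ pos R d.potential u := by
  obtain ⟨y, hy, hyσ⟩ := Set.not_subset.1 (hsub σ hσ)
  obtain ⟨p, hσp⟩ := hR.exists_mem_rangeParts hσ
  obtain ⟨d, hE⟩ := exists_ends_of_notMem hσp (home_subset_block hγ.le _ _ hy) hyσ hu
  refine ⟨d, isSpokesman_potential_iff.2
    ⟨⟨σ, hσ, hE, ⟨pos u, mem_home hγ (pos u), hu⟩, hsub σ hσ⟩, ?_⟩⟩
  rintro k hk τ hτ hEτ ⟨hne, -⟩
  obtain ⟨q, hτq⟩ := hR.exists_mem_rangeParts hτ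
  exact hsub τ hτ (home_subset_of_ends hγ hτq hEτ hk hne)

lemma exists_speaks_not_beyond (hγ : 0 < γ) (hsep : ∀ u v, u ≠ v → γ ≤ |pos u - pos v|)
    (hR : IsRangeFamily s pos R) {σ : Set ℝ} (hσ : σ ∈ R u) (hu : pos u ∈ σ) (d : Side) :
    ∃ v, SameBlock s γ (pos v) (pos u) ∧ ¬ d.Beyond (pos u) (pos v) ∧
      ∃ κ, Speaks s γ pos R κ v := by
  by_cases hsub : ∃ τ ∈ R u, home s γ (pos u) (homeIdx s γ (pos u)) ⊆ τ
  · obtain ⟨τ, hτ, hsubτ⟩ := hsub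
    obtain ⟨v, hvu, huv, hv⟩ := (Classical.em (d.Ends s γ (pos u) τ)).elim
      (exists_speaks_of_ends hγ hR hτ · hsubτ) (exists_speaks_of_not_ends hγ hR hτ · hsubτ)
    exact ⟨v, hvu, not_beyond_of_not_beyond_homeIdx hγ hsep hvu huv, hv⟩
  · obtain ⟨e, he⟩ := exists_speaks_potential hγ hR hσ hu fun τ hτ h => hsub ⟨τ, hτ, h⟩
    exact ⟨u, .refl s γ (pos u), d.not_beyond_self (pos u), _, he⟩

lemma swampGraph_adj_iff (hs : 0 ≤ s) :
    (swampGraph s pos).Adj u v ↔ s < |pos u - pos v| ∧ |pos u - pos v| ≤ 1 := by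
  refine ⟨And.right, fun h => ⟨?_, h⟩⟩
  rintro rfl
  rw [sub_self, abs_zero] at h
  exact hs.not_gt h.1

lemma adj_iff_exists_mem_rangeParts (hs : 0 ≤ s) :
    (swampGraph s pos).Adj u v ↔ ∃ σ ∈ rangeParts s (pos v), pos u ∈ σ := by
  rw [swampGraph_adj_iff hs, exists_mem_rangeParts_iff hs]

lemma adj_or_adj_of_between (hs : 0 ≤ s) {x : V} (hvu : pos v ≤ pos u) (huw : pos u ≤ pos w)
    (hvw : pos w - pos v < 1 - s) (hadj : (swampGraph s pos).Adj x u) :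
    (swampGraph s pos).Adj x v ∨ (swampGraph s pos).Adj x w := by
  obtain ⟨hfar, hnear⟩ := hadj.2
  simp only [swampGraph_adj_iff hs, lt_abs, abs_le] at hfar hnear ⊢
  rcases hfar with hux | hxu
  · rcases lt_or_ge s (pos x - pos w) with hwx | hxw
    · exact .inr ⟨.inl hwx, by linarith, by linarith⟩
    · exact .inl ⟨.inl (by linarith), by linarith, by linarith⟩
  · rcases lt_or_ge s (pos v - pos x) with hxv | hvx
    · exact .inl ⟨.inr (by linarith), by linarith, by linarith⟩
    · exact .inr ⟨.inr (by linarith), by linarith, by linarith⟩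

lemma exists_adj_speaks (hs : 0 ≤ s) (hγ : 0 < γ) (hsep : ∀ u v, u ≠ v → γ ≤ |pos u - pos v|)
    (hR : IsRangeFamily s pos R) {σ : Set ℝ} (hσ : σ ∈ R u) (hu : pos u ∈ σ) {x : V}
    (hadj : (swampGraph s pos).Adj x u) :
    ∃ v, SameBlock s γ (pos v) (pos u) ∧ (swampGraph s pos).Adj x v ∧
      ∃ κ, Speaks s γ pos R κ v := by
  obtain ⟨v, hv, hvu, hspeaks_v⟩ := exists_speaks_not_beyond hγ hsep hR hσ hu .left
  obtain ⟨w, hw, huw, hspeaks_w⟩ := exists_speaks_not_beyond hγ hsep hR hσ hu .right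
  rcases le_total γ (1 - s) with h | h
  · have hvw := (hw.trans hv.symm).abs_sub_lt hγ
    rw [blockLen, max_eq_left h] at hvw
    rcases adj_or_adj_of_between hs (not_lt.1 hvu) (not_lt.1 huw) (lt_of_abs_lt hvw) hadj
      with hxv | hxw
    · exact ⟨v, hv, hxv, hspeaks_v⟩
    · exact ⟨w, hw, hxw, hspeaks_w⟩
  · have hlt := hv.abs_sub_lt hγ
    rw [blockLen, max_eq_right h] at hlt
    obtain rfl : v = u := by_contra fun hne => (hsep v u hne).not_gt hlt
    exact ⟨v, hv, hadj, hspeaks_v⟩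

end Speaks

/-! ### Executions -/

section Execution

variable {V M : Type*} {A : Protocol M} {s γ : ℝ} {pos : V → ℝ} {own : V → Option M} {i t : ℕ}
  {u v : V}

/-- What the node `v` transmits in round `t` of the execution of `A`. -/
noncomputable def action (A : Protocol M) (s γ : ℝ) (pos : V → ℝ) (own : V → Option M) (t : ℕ)
    (v : V) : Option (Msg M) :=
  A s γ (pos v) (own v) (history A s γ pos own t v)

lemma length_history (t : ℕ) (u : V) : (history A s γ pos own t u).length = t := by
  induction t with
  | zero => rfl
  | succ t ih => rw [history, List.length_append, ih, List.length_singleton]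

lemma getElem?_history (hit : i < t) (u : V) :
    (history A s γ pos own t u)[i]? = some (receive s pos (action A s γ pos own i) u) := by
  induction t with
  | zero => exact absurd hit i.not_lt_zero
  | succ t ih =>
    rcases (Nat.lt_succ_iff.1 hit).lt_or_eq with h | rfl
    · rw [history, List.getElem?_append_left (by rwa [length_history]), ih h]
    · rw [history, List.getElem?_append_right (length_history i u).le, length_history, Nat.sub_self]
      rfl

lemma mem_history_iff {r : Option (Msg M)} :
    r ∈ history A s γ pos own t u ↔ ∃ i < t, receive s pos (action A s γ pos own i) u = r := by
  rw [List.mem_iff_getElem?]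
  constructor
  · rintro ⟨i, hi⟩
    have hit : i < t := by
      rw [← length_history (A := A) (s := s) (γ := γ) (pos := pos) (own := own) t u]
      exact (List.getElem?_eq_some_iff.1 hi).1
    rw [getElem?_history hit] at hi
    exact ⟨i, hit, Option.some.inj hi⟩
  · rintro ⟨i, hi, rfl⟩
    exact ⟨i, getElem?_history hi u⟩

lemma mem_heardRanges_history_iff {t₀ : ℕ} (h : t₀ ≤ t) {σ : Set ℝ} :
    σ ∈ heardRanges s (history A s γ pos own t u) t₀ ↔ ∃ i < t₀, ∃ m p,
      receive s pos (action A s γ pos own i) u = some (Msg.data m p) ∧ σ ∈ rangeParts s p := by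
  refine exists_congr fun i => and_congr_right fun hi => ?_
  rw [getElem?_history (hi.trans_le h)]
  simp only [Option.some.injEq]

lemma heardRanges_history {t₀ : ℕ} (h : t₀ ≤ t) (u : V) :
    heardRanges s (history A s γ pos own t u) t₀ =
      heardRanges s (history A s γ pos own t₀ u) t₀ := by
  ext σ
  rw [mem_heardRanges_history_iff h, mem_heardRanges_history_iff le_rfl]

end Execution

section Receive

variable {V M : Type*} {s : ℝ} {pos : V → ℝ} {act : V → Option (Msg M)} {u v : V}

lemma receive_eq_of_unique (hadj : (swampGraph s pos).Adj u v) (hv : act v ≠ none)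
    (hunique : ∀ w, |pos u - pos w| ≤ 1 → act w ≠ none → w = v) :
    receive s pos act u = act v := by
  have hadj_unique : ∀ w, (swampGraph s pos).Adj u w ∧ act w ≠ none → w = v :=
    fun w hw => hunique w hw.1.2.2 hw.2
  have h : act u = none ∧ (∀ w, |pos u - pos w| ≤ s → act w = none) ∧
      ∃! w, (swampGraph s pos).Adj u w ∧ act w ≠ none := by
    refine ⟨by_contra fun hu => hadj.1 (hunique u (by simp) hu),
      fun w hw => by_contra fun hact => hw.not_gt ?_, v, ⟨hadj, hv⟩, hadj_unique⟩
    rw [hunique w (hw.trans (hadj.2.1.le.trans hadj.2.2)) hact]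
    exact hadj.2.1
  rw [receive, dif_pos h, hadj_unique _ h.2.2.choose_spec.1]

lemma exists_adj_of_receive_eq_some {x : Msg M} (h : receive s pos act u = some x) :
    ∃ v, (swampGraph s pos).Adj u v ∧ act v = some x := by
  unfold receive at h
  split_ifs at h with hc
  exact ⟨_, hc.2.2.choose_spec.1.1, h⟩

lemma receive_eq_none_of_swamped (hv : |pos u - pos v| ≤ s) (hact : act v ≠ none) :
    receive s pos act u = none := by
  rw [receive, dif_neg]
  exact fun h => hact (h.2.1 v hv)

/-- Any two transmitters are more than `2` apart, so that they have no common neighbour. -/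
def Uncrowded (pos : V → ℝ) (act : V → Option (Msg M)) : Prop :=
  ∀ v w, act v ≠ none → act w ≠ none → |pos v - pos w| ≤ 2 → v = w

lemma abs_sub_le_two {x y z : ℝ} (hy : |x - y| ≤ 1) (hz : |x - z| ≤ 1) : |y - z| ≤ 2 := by
  rw [abs_sub_comm] at hy
  linarith [abs_sub_le y x z]

lemma Uncrowded.receive_eq (h : Uncrowded pos act) (hadj : (swampGraph s pos).Adj u v)
    (hv : act v ≠ none) : receive s pos act u = act v :=
  receive_eq_of_unique hadj hv fun w hw hact => h w v hact hv (abs_sub_le_two hw hadj.2.2)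

end Receive

/-! ### Neighbourhood discovery -/

section Schedule

variable {s γ : ℝ}

lemma exists_loopLabel_eq (hγ : 0 < γ) (x : ℝ) :
    ∃ i < numLabels s γ, loopLabel s γ i = label s γ x := by
  have hb := blockIdx_lt (s := s) hγ x
  have hh := homeIdx_lt (s := s) hγ x
  refine ⟨numHomes s γ * blockIdx s γ x + homeIdx s γ x, ?_, ?_⟩
  · calc numHomes s γ * blockIdx s γ x + homeIdx s γ x
        < numHomes s γ * (blockIdx s γ x + 1) := by rw [mul_add_one]; gcongr
      _ ≤ numHomes s γ * numBlocks s γ := by gcongr; exact hb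
      _ = numLabels s γ := mul_comm _ _
  · rw [loopLabel, Nat.mul_add_div (Nat.zero_lt_of_lt hh), Nat.div_eq_of_lt hh, Nat.mul_add_mod,
      Nat.mod_eq_of_lt hh]
    rfl

lemma exists_loopLabel_pair_eq (hγ : 0 < γ) (x y : ℝ) :
    ∃ j < numLabels s γ ^ 2, loopLabel s γ (j / numLabels s γ) = label s γ x ∧
      loopLabel s γ (j % numLabels s γ) = label s γ y := by
  obtain ⟨i, hi, hx⟩ := exists_loopLabel_eq (s := s) hγ x
  obtain ⟨k, hk, hy⟩ := exists_loopLabel_eq (s := s) hγ y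
  refine ⟨numLabels s γ * i + k, ?_, ?_, ?_⟩
  · calc numLabels s γ * i + k < numLabels s γ * (i + 1) := by rw [mul_add_one]; gcongr
      _ ≤ numLabels s γ ^ 2 := by rw [sq]; gcongr; exact hi
  · rw [Nat.mul_add_div (Nat.zero_lt_of_lt hk), Nat.div_eq_of_lt hk, add_zero, hx]
  · rw [Nat.mul_add_mod, Nat.mod_eq_of_lt hk, hy]

lemma dStarTransmits_iff_of_lt {x : ℝ} {t : ℕ} (ht : t < numLabels s γ) :
    dStarTransmits s γ x t ↔ label s γ x = loopLabel s γ t := by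
  simp only [dStarTransmits, ht, ht.not_ge, true_and, false_and, or_false]

lemma dStarTransmits_add_iff {x : ℝ} {j : ℕ} :
    dStarTransmits s γ x (numLabels s γ + j) ↔
      label s γ x = loopLabel s γ (j / numLabels s γ) ∨
      label s γ x = loopLabel s γ (j % numLabels s γ) := by
  simp only [dStarTransmits, Nat.not_lt.2 (Nat.le_add_right _ _), Nat.le_add_right,
    Nat.add_sub_cancel_left, false_and, true_and, false_or]

end Schedule

section Discovery

variable {V M : Type*} {s γ : ℝ} {pos : V → ℝ} {own : V → Option M} {i j t : ℕ} {u v w : V}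

/-- The nodes of the network and its parameters `s` and `γ` are as the model requires. -/
structure IsPlacement (s γ : ℝ) (pos : V → ℝ) : Prop where
  swamping_nonneg : 0 ≤ s
  gap_pos : 0 < γ
  gap_le_one : γ ≤ 1
  gap_le : ∀ u v, u ≠ v → γ ≤ |pos u - pos v|

lemma IsPlacement.eq_of_label_eq (hpos : IsPlacement s γ pos) (hv : |pos u - pos v| ≤ 1)
    (hw : |pos u - pos w| ≤ 1) (h : label s γ (pos v) = label s γ (pos w)) : v = w := by
  obtain ⟨hb, hh⟩ := Prod.mk.inj h
  exact eq_of_homeIdx_eq hpos.gap_pos hpos.gap_le (sameBlock_of_abs_sub_le_two hpos.swamping_nonneg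
    hpos.gap_pos hpos.gap_le_one hb (abs_sub_le_two hv hw)) hh

lemma action_eq_hello (ht : t < dStarRounds s γ) (hv : dStarTransmits s γ (pos v) t) :
    action (algorithmB M) s γ pos own t v = some Msg.hello := by
  simp only [action, algorithmB, length_history, ht, hv, if_true]

lemma action_ne_none_iff (ht : t < dStarRounds s γ) :
    action (algorithmB M) s γ pos own t v ≠ none ↔ dStarTransmits s γ (pos v) t := by
  simp only [action, algorithmB, length_history, ht, if_true, ne_eq, ite_eq_right_iff,
    reduceCtorEq, imp_false, not_not]

lemma receive_eq_hello_iff (hpos : IsPlacement s γ pos) (hi : i < numLabels s γ) :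
    receive s pos (action (algorithmB M) s γ pos own i) u = some Msg.hello ↔
      ∃ v, (swampGraph s pos).Adj u v ∧ label s γ (pos v) = loopLabel s γ i := by
  have ht : i < dStarRounds s γ := hi.trans_le (Nat.le_add_right _ _)
  simp only [← dStarTransmits_iff_of_lt hi]
  constructor
  · intro h
    obtain ⟨v, hadj, hv⟩ := exists_adj_of_receive_eq_some h
    exact ⟨v, hadj, (action_ne_none_iff ht).1 (by rw [hv]; exact Option.some_ne_none _)⟩
  · rintro ⟨v, hadj, hv⟩
    rw [receive_eq_of_unique hadj ((action_ne_none_iff ht).2 hv), action_eq_hello ht hv]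
    intro w hw hact
    rw [action_ne_none_iff ht, dStarTransmits_iff_of_lt hi] at hact
    rw [dStarTransmits_iff_of_lt hi] at hv
    exact hpos.eq_of_label_eq hw hadj.2.2 (hact.trans hv.symm)

lemma mem_heardLabels_iff (hpos : IsPlacement s γ pos) (ht : dStarRounds s γ ≤ t) {c : ℕ × ℕ} :
    c ∈ heardLabels s γ (history (algorithmB M) s γ pos own t u) ↔
      ∃ v, (swampGraph s pos).Adj u v ∧ label s γ (pos v) = c := by
  have heard_iff {i : ℕ} (hi : i < numLabels s γ) :
      (history (algorithmB M) s γ pos own t u)[i]? = some (some Msg.hello) ↔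
        ∃ v, (swampGraph s pos).Adj u v ∧ label s γ (pos v) = loopLabel s γ i := by
    rw [getElem?_history (hi.trans_le ((Nat.le_add_right _ _).trans ht)), Option.some_inj,
      receive_eq_hello_iff hpos hi]
  constructor
  · rintro ⟨i, hi, rfl, h⟩
    exact (heard_iff hi).1 h
  · rintro ⟨v, hadj, rfl⟩
    obtain ⟨i, hi, hv⟩ := exists_loopLabel_eq (s := s) hpos.gap_pos (pos v)
    exact ⟨i, hi, hv, (heard_iff hi).2 ⟨v, hadj, hv.symm⟩⟩

lemma receive_pair_eq_none (hj : j < numLabels s γ ^ 2)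
    (hv : label s γ (pos v) = loopLabel s γ (j % numLabels s γ)) (hs : |pos u - pos v| ≤ s) :
    receive s pos (action (algorithmB M) s γ pos own (numLabels s γ + j)) u = none :=
  receive_eq_none_of_swamped hs <| (action_ne_none_iff (Nat.add_lt_add_left hj _)).2 <|
    dStarTransmits_add_iff.2 (.inr hv)

lemma exists_near_of_receive_pair_eq_none (hpos : IsPlacement s γ pos)
    (hj : j < numLabels s γ ^ 2) (hadj : (swampGraph s pos).Adj u v)
    (hv : label s γ (pos v) = loopLabel s γ (j / numLabels s γ))
    (hu : ¬ dStarTransmits s γ (pos u) (numLabels s γ + j))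
    (h : receive s pos (action (algorithmB M) s γ pos own (numLabels s γ + j)) u = none) :
    ∃ w ≠ u, |pos u - pos w| ≤ 1 ∧ label s γ (pos w) = loopLabel s γ (j % numLabels s γ) := by
  have hact {w : V} := action_ne_none_iff (M := M) (pos := pos) (own := own) (v := w)
    (Nat.add_lt_add_left hj (numLabels s γ))
  by_contra! hnone
  have hv' := hact.2 (dStarTransmits_add_iff.2 (.inl hv))
  refine hv' ((receive_eq_of_unique hadj hv' fun w hw hw' => ?_).symm.trans h)
  rcases dStarTransmits_add_iff.1 (hact.1 hw') with hwv | hwj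
  · exact hpos.eq_of_label_eq hw hadj.2.2 (hwv.trans hv.symm)
  · have hwu : w ≠ u := by
      rintro rfl
      exact hu (hact.1 hw')
    exact absurd hwj (hnone w hwu hw)

lemma mem_knownLabels_of_swamped (hpos : IsPlacement s γ pos)
    (hconn : (swampGraph s pos).Preconnected) (ht : dStarRounds s γ ≤ t) (hvu : v ≠ u)
    (hv : |pos u - pos v| ≤ s) :
    label s γ (pos v) ∈ knownLabels s γ (pos u) (history (algorithmB M) s γ pos own t u) := by
  have : Nontrivial V := ⟨v, u, hvu⟩
  obtain ⟨w, hw⟩ := hconn.exists_adj_of_nontrivial u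
  obtain ⟨j, hj, hjw, hjv⟩ := exists_loopLabel_pair_eq (s := s) hpos.gap_pos (pos w) (pos v)
  refine .inr ⟨j, hj, hjv, (mem_heardLabels_iff hpos ht).2 ⟨w, hw, hjw.symm⟩, ?_, ?_⟩
  · rw [dStarTransmits_add_iff, hjw, hjv]
    rintro (h | h)
    · exact hw.1 (hpos.eq_of_label_eq (by simp) hw.2.2 h)
    · exact hvu (hpos.eq_of_label_eq (by simp) (hv.trans (hw.2.1.le.trans hw.2.2)) h).symm
  · rw [getElem?_history ((Nat.add_lt_add_left hj _).trans_le ht),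
      receive_pair_eq_none hj hjv.symm hv]

lemma knownLabels_eq (hpos : IsPlacement s γ pos) (hconn : (swampGraph s pos).Preconnected)
    (ht : dStarRounds s γ ≤ t) (u : V) :
    knownLabels s γ (pos u) (history (algorithmB M) s γ pos own t u) =
      {a | ∃ v, v ≠ u ∧ |pos u - pos v| ≤ 1 ∧ label s γ (pos v) = a} := by
  ext c
  constructor
  · rintro (hc | ⟨j, hj, rfl, hheard, hlisten, hr⟩)
    · obtain ⟨v, hadj, rfl⟩ := (mem_heardLabels_iff hpos ht).1 hc
      exact ⟨v, hadj.ne', hadj.2.2, rfl⟩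
    · obtain ⟨v, hadj, hv⟩ := (mem_heardLabels_iff hpos ht).1 hheard
      rw [getElem?_history ((Nat.add_lt_add_left hj _).trans_le ht)] at hr
      exact exists_near_of_receive_pair_eq_none hpos hj hadj hv hlisten (Option.some.inj hr)
  · rintro ⟨v, hvu, hv, rfl⟩
    rcases lt_or_ge s |pos u - pos v| with hs | hs
    · exact .inl ((mem_heardLabels_iff hpos ht).2 ⟨v, ⟨hvu.symm, hs, hv⟩, rfl⟩)
    · exact mem_knownLabels_of_swamped hpos hconn ht hvu hs

lemma occupied_eq (hpos : IsPlacement s γ pos) (hconn : (swampGraph s pos).Preconnected)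
    (ht : dStarRounds s γ ≤ t) (u : V) :
    occupied s γ (pos u) (history (algorithmB M) s γ pos own t u) =
      occupiedHomes s γ pos (pos u) := by
  have ⟨hs, hγ, hγ1, _⟩ := hpos
  ext k
  simp only [occupied, knownLabels_eq hpos hconn ht, Set.mem_ofPred_eq, occupiedHomes, label]
  constructor
  · rintro (rfl | ⟨v, -, hv, h⟩)
    · exact ⟨u, .refl s γ (pos u), rfl⟩
    · obtain ⟨hb, hk⟩ := Prod.mk.inj h
      rw [abs_sub_comm] at hv
      exact ⟨v, sameBlock_of_abs_sub_le_two hs hγ hγ1 hb (by linarith), hk⟩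
  · rintro ⟨v, hv, rfl⟩
    rcases eq_or_ne v u with rfl | hvu
    · exact .inl rfl
    · have hlt := hv.symm.abs_sub_lt hγ
      exact .inr ⟨v, hvu, hlt.le.trans (blockLen_le_one hs hγ1), by rw [hv.2]⟩

end Discovery

/-! ### Dissemination -/

section KnownMessage

variable {M : Type*} {own : Option M} {h : History M} {a : M} {p : ℝ}

lemma eq_some_or_exists_mem_of_knownMessage_eq_some (ha : knownMessage own h = some a) :
    own = some a ∨ ∃ p, some (Msg.data a p) ∈ h := by
  cases own with
  | some b => exact .inl ha
  | none =>
    obtain ⟨_ | _ | ⟨_, p⟩, hr, hra⟩ := List.exists_of_findSome?_eq_some (l := h) ha <;> cases hra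
    exact .inr ⟨p, hr⟩

lemma knownMessage_ne_none_of_mem (ha : some (Msg.data a p) ∈ h) : knownMessage own h ≠ none := by
  intro hnone
  cases own with
  | some b => cases hnone
  | none => cases (List.findSome?_eq_none_iff (l := h)).1 hnone _ ha

lemma IsSpokesman.nonempty {s γ x : ℝ} {O : Set ℕ} {R : Set (Set ℝ)} {κ : Kind}
    (hκ : IsSpokesman s γ x O R κ) : R.Nonempty := by
  cases κ <;> exact hκ.1.imp fun _ => And.left

lemma knownMessage_ne_none_of_tTransmits {s γ x : ℝ} {i : ℕ} (hi : tTransmits s γ x h i) :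
    knownMessage own h ≠ none := by
  obtain ⟨_, _, _, _, _, hmem, _⟩ := hi.2.nonempty
  exact knownMessage_ne_none_of_mem (List.mem_of_getElem? hmem)

lemma exists_kindOf_eq (κ : Kind) : ∃ k < 6, kindOf k = κ := by
  cases κ
  exacts [⟨0, by simp, rfl⟩, ⟨1, by simp, rfl⟩, ⟨2, by simp, rfl⟩, ⟨3, by simp, rfl⟩,
    ⟨4, by simp, rfl⟩, ⟨5, by simp, rfl⟩]

end KnownMessage

section Dissemination

variable {V M : Type*} {s γ : ℝ} {pos : V → ℝ} {src : V} {m : M} {i n t : ℕ} {u v w : V}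

/-- The history of `v` after `t` rounds of Algorithm `B` with source `src` and message `m`. -/
noncomputable abbrev hist (s γ : ℝ) (pos : V → ℝ) (src : V) (m : M) (t : ℕ) (v : V) : History M :=
  history (algorithmB M) s γ pos (sourceInput src m) t v

/-- What `v` transmits in round `t` of Algorithm `B` with source `src` and message `m`. -/
noncomputable abbrev sent (s γ : ℝ) (pos : V → ℝ) (src : V) (m : M) (t : ℕ) (v : V) :
    Option (Msg M) :=
  action (algorithmB M) s γ pos (sourceInput src m) t v

/-- The parts of the ranges of all senders from which `u` has received the source message in the
first `t` rounds. -/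
def ranges (s γ : ℝ) (pos : V → ℝ) (src : V) (m : M) (t : ℕ) (u : V) : Set (Set ℝ) :=
  heardRanges s (hist s γ pos src m t u) t

/-- Another node has transmitted the source message to `u` in the first `t` rounds. -/
def Received (s γ : ℝ) (pos : V → ℝ) (src : V) (m : M) (t : ℕ) (u : V) : Prop :=
  ∃ p, some (Msg.data m p) ∈ hist s γ pos src m t u

open Classical in
lemma sent_dStarRounds (v : V) : sent s γ pos src m (dStarRounds s γ) v =
    if v = src then some (Msg.data m (pos v)) else none := by
  simp only [sent, action, algorithmB, length_history, lt_irrefl, if_false, if_true, sourceInput,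
    apply_ite (Option.map _), Option.map_some, Option.map_none]

open Classical in
lemma sent_dStarRounds_add (i : ℕ) (v : V) :
    sent s γ pos src m (dStarRounds s γ + 1 + i) v =
      if tTransmits s γ (pos v) (hist s γ pos src m (dStarRounds s γ + 1 + i) v) i then
        (knownMessage (sourceInput src m v) (hist s γ pos src m (dStarRounds s γ + 1 + i) v)).map
          fun a => Msg.data a (pos v)
      else none := by
  have hlt : ¬ dStarRounds s γ + 1 + i < dStarRounds s γ := by lia
  have hne : dStarRounds s γ + 1 + i ≠ dStarRounds s γ := by lia
  simp only [sent, action, algorithmB, length_history, hlt, hne, if_false, Nat.add_sub_cancel_left]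

lemma dStarRounds_le_of_sent_eq_data {a : M} {p : ℝ}
    (h : sent s γ pos src m t v = some (Msg.data a p)) : dStarRounds s γ ≤ t := by
  by_contra! ht
  have hne := Option.ne_none_iff_exists'.2 ⟨_, h⟩
  cases h.symm.trans (action_eq_hello ht ((action_ne_none_iff ht).1 hne))

open Classical in
lemma sent_eq_data (ht : dStarRounds s γ ≤ t) (hv : sent s γ pos src m t v ≠ none) :
    sent s γ pos src m t v = some (Msg.data m (pos v)) := by
  induction t using Nat.strong_induction_on generalizing v with
  | _ t ih =>
    rcases ht.eq_or_lt with rfl | hlt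
    · rw [sent_dStarRounds] at hv ⊢
      rw [if_pos (ite_ne_right_iff.1 hv).1]
    · obtain ⟨i, rfl⟩ := Nat.exists_eq_add_of_le (Nat.succ_le_of_lt hlt)
      rw [Nat.succ_eq_add_one, sent_dStarRounds_add] at hv ⊢
      obtain ⟨hT, hknown⟩ := ite_ne_right_iff.1 hv
      obtain ⟨a, ha⟩ := Option.ne_none_iff_exists'.1 (mt Option.map_eq_none_iff.2 hknown)
      rw [if_pos hT, ha, Option.map_some]
      suffices ham : a = m by rw [ham]
      rcases eq_some_or_exists_mem_of_knownMessage_eq_some ha with hown | ⟨p, hp⟩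
      · exact (Option.ite_some_none_eq_some.1 hown).2.symm
      · obtain ⟨j, hj, hr⟩ := mem_history_iff.1 hp
        obtain ⟨w, -, hw⟩ := exists_adj_of_receive_eq_some hr
        have hdata := ih j hj (dStarRounds_le_of_sent_eq_data hw)
          (Option.ne_none_iff_exists'.2 ⟨_, hw⟩)
        cases hw.symm.trans hdata
        rfl

lemma isRangeFamily_ranges (hs : 0 ≤ s)
    (hU : ∀ i < t, dStarRounds s γ ≤ i → Uncrowded pos (sent s γ pos src m i)) :
    IsRangeFamily s pos (ranges s γ pos src m t) where
  exists_mem_rangeParts := by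
    rintro u σ ⟨-, -, -, p, -, hσ⟩
    exact ⟨p, hσ⟩
  mem_of_mem := by
    intro u v σ hσu hv
    obtain ⟨i, hi, a, p, hr, hσ⟩ := (mem_heardRanges_history_iff le_rfl).1 hσu
    obtain ⟨w, -, hw⟩ := exists_adj_of_receive_eq_some hr
    have hD := dStarRounds_le_of_sent_eq_data hw
    have hne : sent s γ pos src m i w ≠ none := Option.ne_none_iff_exists'.2 ⟨_, hw⟩
    cases hw.symm.trans (sent_eq_data hD hne)
    have hadj := (adj_iff_exists_mem_rangeParts hs).2 ⟨σ, hσ, hv⟩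
    exact (mem_heardRanges_history_iff le_rfl).2
      ⟨i, hi, m, pos w, ((hU i hi hD).receive_eq hadj hne).trans hw, hσ⟩

open Classical in
lemma sent_dStarRounds_add_ne_none_iff (hpos : IsPlacement s γ pos)
    (hconn : (swampGraph s pos).Preconnected) :
    sent s γ pos src m (dStarRounds s γ + 1 + i) v ≠ none ↔
      blockIdx s γ (pos v) = i % (6 * numBlocks s γ) / 6 ∧
      Speaks s γ pos (ranges s γ pos src m (dStarRounds s γ + 1 + (i - i % 6))) (kindOf (i % 6))
        v := by
  rw [sent_dStarRounds_add, ite_ne_right_iff, and_iff_left_of_imp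
    fun h => mt Option.map_eq_none_iff.1 (knownMessage_ne_none_of_tTransmits h), tTransmits,
    occupied_eq hpos hconn (by lia), heardRanges_history (by lia)]
  rfl

open Classical in
lemma uncrowded_sent (hpos : IsPlacement s γ pos) (hconn : (swampGraph s pos).Preconnected)
    (ht : dStarRounds s γ ≤ t) : Uncrowded pos (sent s γ pos src m t) := by
  induction t using Nat.strong_induction_on with
  | _ t ih =>
    have ⟨hs, hγ, hγ1, hsep⟩ := hpos
    intro v w hv hw hvw
    rcases ht.eq_or_lt with rfl | hlt
    · rw [sent_dStarRounds] at hv hw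
      exact (ite_ne_right_iff.1 hv).1.trans (ite_ne_right_iff.1 hw).1.symm
    · obtain ⟨i, rfl⟩ := Nat.exists_eq_add_of_le (Nat.succ_le_of_lt hlt)
      obtain ⟨hbv, hspeaks_v⟩ := (sent_dStarRounds_add_ne_none_iff hpos hconn).1 hv
      obtain ⟨hbw, hspeaks_w⟩ := (sent_dStarRounds_add_ne_none_iff hpos hconn).1 hw
      exact eq_of_speaks hγ hsep (isRangeFamily_ranges hs fun j hj => ih j (by lia))
        hspeaks_v hspeaks_w (sameBlock_of_abs_sub_le_two hs hγ hγ1 (hbv.trans hbw.symm) hvw)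

lemma received_of_sent (hpos : IsPlacement s γ pos) (hconn : (swampGraph s pos).Preconnected)
    (hi : dStarRounds s γ ≤ i) (hit : i < t) (hv : sent s γ pos src m i v ≠ none)
    (hadj : (swampGraph s pos).Adj u v) : Received s γ pos src m t u :=
  ⟨pos v, mem_history_iff.2 ⟨i, hit,
    ((uncrowded_sent hpos hconn hi).receive_eq hadj hv).trans (sent_eq_data hi hv)⟩⟩

lemma Received.mono {t' : ℕ} (h : t ≤ t') (hu : Received s γ pos src m t u) :
    Received s γ pos src m t' u := by
  obtain ⟨p, hp⟩ := hu
  obtain ⟨i, hi, hr⟩ := mem_history_iff.1 hp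
  exact ⟨p, mem_history_iff.2 ⟨i, hi.trans_le h, hr⟩⟩

lemma Received.exists_mem_ranges (hs : 0 ≤ s) (hu : Received s γ pos src m t u) :
    ∃ σ ∈ ranges s γ pos src m t u, pos u ∈ σ := by
  obtain ⟨p, hp⟩ := hu
  obtain ⟨i, hi, hr⟩ := mem_history_iff.1 hp
  obtain ⟨v, hadj, hv⟩ := exists_adj_of_receive_eq_some hr
  cases hv.symm.trans (sent_eq_data (dStarRounds_le_of_sent_eq_data hv)
    (Option.ne_none_iff_exists'.2 ⟨_, hv⟩))
  obtain ⟨σ, hσ, huσ⟩ := (adj_iff_exists_mem_rangeParts hs).1 hadj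
  exact ⟨σ, (mem_heardRanges_history_iff le_rfl).2 ⟨i, hi, m, pos v, hr, hσ⟩, huσ⟩

/-- The number of rounds of Algorithm `B` before those of the blocks numbered `b` in the sweep
numbered `n`, both counted from `0`. -/
noncomputable def turnStart (s γ : ℝ) (n b : ℕ) : ℕ :=
  dStarRounds s γ + 1 + (6 * numBlocks s γ * n + 6 * b)

lemma sent_ne_none_of_speaks (hpos : IsPlacement s γ pos)
    (hconn : (swampGraph s pos).Preconnected) {k : ℕ} (hk : k < 6)
    (hv : Speaks s γ pos (ranges s γ pos src m (turnStart s γ n (blockIdx s γ (pos v))))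
      (kindOf k) v) :
    sent s γ pos src m (turnStart s γ n (blockIdx s γ (pos v)) + k) v ≠ none := by
  have hb := blockIdx_lt (s := s) hpos.gap_pos (pos v)
  rw [turnStart] at hv ⊢
  rw [add_assoc, sent_dStarRounds_add_ne_none_iff hpos hconn]
  generalize blockIdx s γ (pos v) = b at *
  have hkind : (6 * numBlocks s γ * n + 6 * b + k) % 6 = k := by
    rw [mul_assoc]
    lia
  refine ⟨?_, ?_⟩
  · rw [add_assoc, Nat.mul_add_mod, Nat.mod_eq_of_lt (by lia)]
    lia
  · rwa [hkind, Nat.add_sub_cancel]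

lemma received_of_adj (hpos : IsPlacement s γ pos) (hconn : (swampGraph s pos).Preconnected)
    (hadj : (swampGraph s pos).Adj w u) (hu : Received s γ pos src m (turnStart s γ n 0) u) :
    Received s γ pos src m (turnStart s γ (n + 1) 0) w := by
  have ⟨hs, hγ, _, hsep⟩ := hpos
  have hb := blockIdx_lt (s := s) hγ (pos u)
  obtain ⟨σ, hσ, huσ⟩ := Received.exists_mem_ranges (t := turnStart s γ n (blockIdx s γ (pos u))) hs
    (hu.mono (by unfold turnStart; lia))
  obtain ⟨v, hvu, hwv, κ, hκ⟩ := exists_adj_speaks hs hγ hsep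
    (isRangeFamily_ranges hs fun _ _ => uncrowded_sent hpos hconn) hσ huσ hadj
  obtain ⟨k, hk, rfl⟩ := exists_kindOf_eq κ
  rw [← hvu.2] at hκ hb
  refine received_of_sent hpos hconn ?_ ?_ (sent_ne_none_of_speaks hpos hconn hk hκ) hwv
  · unfold turnStart
    lia
  · rw [turnStart, turnStart, mul_add_one]
    lia

lemma informed_of_walk (hpos : IsPlacement s γ pos) (hconn : (swampGraph s pos).Preconnected)
    (p : (swampGraph s pos).Walk u src) :
    Informed (algorithmB M) s γ pos src m (turnStart s γ p.length 0) u := by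
  induction p with
  | nil => exact .inl rfl
  | @cons w u src hadj p ih =>
    right
    rcases ih with rfl | hu
    · refine received_of_sent hpos hconn le_rfl (by unfold turnStart; lia) ?_ hadj
      rw [sent_dStarRounds, if_pos rfl]
      exact Option.some_ne_none _
    · exact received_of_adj hpos hconn hadj hu

lemma informed_of_dist_le (hpos : IsPlacement s γ pos) (hconn : (swampGraph s pos).Connected)
    {d : ℕ} (hd : (swampGraph s pos).dist u src ≤ d) :
    Informed (algorithmB M) s γ pos src m (turnStart s γ d 0) u := by
  obtain ⟨p, hp⟩ := hconn.exists_walk_length_eq_dist u src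
  refine (informed_of_walk hpos hconn.preconnected p).imp_right (Received.mono ?_)
  unfold turnStart
  gcongr
  exact hp.trans_le hd

end Dissemination

/-! ### Running times -/

section Bounds

variable {s γ : ℝ}

lemma numBlocks_le (hs : 0 ≤ s) (hγ : 0 < γ) (hγ1 : γ ≤ 1) :
    (numBlocks s γ : ℝ) ≤ 4 / blockLen s γ := by
  have hl := blockLen_pos (s := s) hγ
  calc (numBlocks s γ : ℝ) ≤ 3 / blockLen s γ + 1 := (Nat.ceil_lt_add_one (by positivity)).le
    _ ≤ 3 / blockLen s γ + 1 / blockLen s γ := by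
      gcongr
      exact (one_le_div hl).2 (blockLen_le_one hs hγ1)
    _ = 4 / blockLen s γ := by ring

lemma numHomes_le (hγ : 0 < γ) : (numHomes s γ : ℝ) ≤ 2 * (blockLen s γ / γ) := by
  have hl := blockLen_pos (s := s) hγ
  calc (numHomes s γ : ℝ) ≤ blockLen s γ / γ + 1 := (Nat.ceil_lt_add_one (by positivity)).le
    _ ≤ blockLen s γ / γ + blockLen s γ / γ := by
      gcongr
      exact (one_le_div hγ).2 (le_max_right _ _)
    _ = 2 * (blockLen s γ / γ) := by ring

lemma numLabels_le (hs : 0 ≤ s) (hγ : 0 < γ) (hγ1 : γ ≤ 1) :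
    (numLabels s γ : ℝ) ≤ 8 * (1 / γ) := by
  have hl := blockLen_pos (s := s) hγ
  calc (numLabels s γ : ℝ) = numBlocks s γ * numHomes s γ := Nat.cast_mul _ _
    _ ≤ 4 / blockLen s γ * (2 * (blockLen s γ / γ)) := by
      gcongr
      · exact numBlocks_le hs hγ hγ1
      · exact numHomes_le hγ
    _ = 8 * (1 / γ) := by
      field_simp
      norm_num

lemma le_numLabels (hγ : 0 < γ) : 3 * (1 / γ) ≤ (numLabels s γ : ℝ) := by
  have hl := blockLen_pos (s := s) hγ
  calc 3 * (1 / γ) = 3 / blockLen s γ * (blockLen s γ / γ) := by field_simp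
    _ ≤ numBlocks s γ * numHomes s γ := by gcongr <;> exact Nat.le_ceil _
    _ = numLabels s γ := (Nat.cast_mul _ _).symm

lemma le_dStarRounds (hγ : 0 < γ) : 9 * (1 / γ) ^ 2 ≤ (dStarRounds s γ : ℝ) := by
  calc 9 * (1 / γ) ^ 2 = (3 * (1 / γ)) ^ 2 := by ring
    _ ≤ (numLabels s γ : ℝ) ^ 2 := by
      gcongr
      exact le_numLabels hγ
    _ ≤ numLabels s γ + (numLabels s γ : ℝ) ^ 2 := le_add_of_nonneg_left (Nat.cast_nonneg _)
    _ = dStarRounds s γ := by rw [dStarRounds, Nat.cast_add, Nat.cast_pow]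

lemma dStarRounds_le (hs : 0 ≤ s) (hγ : 0 < γ) (hγ1 : γ ≤ 1) :
    (dStarRounds s γ : ℝ) ≤ 72 * (1 / γ) ^ 2 := by
  have hg : 1 / γ ≤ (1 / γ) ^ 2 := le_self_pow₀ ((one_le_div hγ).2 hγ1) two_ne_zero
  have hL := numLabels_le hs hγ hγ1
  calc (dStarRounds s γ : ℝ) = numLabels s γ + (numLabels s γ : ℝ) ^ 2 := by
        rw [dStarRounds, Nat.cast_add, Nat.cast_pow]
    _ ≤ 8 * (1 / γ) + (8 * (1 / γ)) ^ 2 := by gcongr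
    _ = 8 * (1 / γ) + 64 * (1 / γ) ^ 2 := by ring
    _ ≤ 72 * (1 / γ) ^ 2 := by linarith

lemma sweepRounds_le (hs : 0 ≤ s) (hγ : 0 < γ) (hγ1 : γ ≤ 1) {d : ℕ} (hd : 1 ≤ d) :
    ((1 + 6 * numBlocks s γ * d : ℕ) : ℝ) ≤ 25 * (d / blockLen s γ) := by
  have hl := blockLen_pos (s := s) hγ
  have hd1 : (1 : ℝ) ≤ d := Nat.one_le_cast.2 hd
  calc ((1 + 6 * numBlocks s γ * d : ℕ) : ℝ) = 1 + 6 * numBlocks s γ * d := by push_cast; rfl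
    _ ≤ d / blockLen s γ + 6 * (4 / blockLen s γ) * d := by
      gcongr
      · exact (one_le_div hl).2 ((blockLen_le_one hs hγ1).trans hd1)
      · exact numBlocks_le hs hγ hγ1
    _ = 25 * (d / blockLen s γ) := by ring

lemma exists_rounds_informed {V M : Type*} {pos : V → ℝ} (hpos : IsPlacement s γ pos)
    (hconn : (swampGraph s pos).Connected) (src : V) (m : M) (d : ℕ) :
    ∃ T : ℕ, (T : ℝ) ≤ 25 * (d / blockLen s γ) ∧
      ∀ u, (swampGraph s pos).dist u src ≤ d →
        Informed (algorithmB M) s γ pos src m (dStarRounds s γ + T) u := by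
  have ⟨hs, hγ, hγ1, _⟩ := hpos
  rcases d.eq_zero_or_pos with rfl | hd
  · exact ⟨0, by simp, fun u hu => .inl (hconn.dist_eq_zero_iff.1 (Nat.le_zero.1 hu))⟩
  · refine ⟨1 + 6 * numBlocks s γ * d, sweepRounds_le hs hγ hγ1 hd, fun u hu => ?_⟩
    rw [← add_assoc]
    exact informed_of_dist_le hpos hconn hu

end Bounds

end Highway

theorem theorem2_general :
    ∃ c C : ℝ, 0 < c ∧ 0 < C ∧
      ∀ (s γ : ℝ), 0 ≤ s → 0 < γ → γ ≤ 1 →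
      ∀ (V : Type*) (pos : V → ℝ),
        (∀ u v : V, u ≠ v → γ ≤ |pos u - pos v|) →
        (Highway.swampGraph s pos).Connected →
      ∀ (M : Type*) (src : V) (m : M),
        c * (1 / γ) ^ 2 ≤ (Highway.dStarRounds s γ : ℝ) ∧
        (Highway.dStarRounds s γ : ℝ) ≤ C * (1 / γ) ^ 2 ∧
        (∀ u : V, Highway.knownLabels s γ (pos u)
            (Highway.history (Highway.algorithmB M) s γ pos (Highway.sourceInput src m)
              (Highway.dStarRounds s γ) u) =
          {a | ∃ v : V, v ≠ u ∧ |pos u - pos v| ≤ 1 ∧ Highway.label s γ (pos v) = a}) ∧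
        ∀ d : ℕ, ∃ T : ℕ,
          (T : ℝ) ≤ C * (d / max (1 - s) γ) ∧
          ((Highway.dStarRounds s γ + T : ℕ) : ℝ) ≤ C * (d / max (1 - s) γ + (1 / γ) ^ 2) ∧
          ∀ u : V, (Highway.swampGraph s pos).dist u src ≤ d →
            Highway.Informed (Highway.algorithmB M) s γ pos src m
              (Highway.dStarRounds s γ + T) u := by
  refine ⟨9, 72, by norm_num, by norm_num, fun s γ hs hγ hγ1 V pos hsep hconn M src m => ?_⟩
  have hpos : Highway.IsPlacement s γ pos := ⟨hs, hγ, hγ1, hsep⟩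
  have hup := Highway.dStarRounds_le hs hγ hγ1
  refine ⟨Highway.le_dStarRounds hγ, hup,
    Highway.knownLabels_eq hpos hconn.preconnected le_rfl, fun d => ?_⟩
  obtain ⟨T, hT, hinformed⟩ := Highway.exists_rounds_informed hpos hconn src m d
  have hT' : (T : ℝ) ≤ 72 * (d / max (1 - s) γ) := hT.trans <| by
    rw [Highway.blockLen]
    gcongr
    norm_num
  refine ⟨T, hT', ?_, hinformed⟩
  push_cast
  linarith

theorem theorem2 :
    ∃ c C : ℝ, 0 < c ∧ 0 < C ∧
      ∀ (s γ : ℝ), 0 ≤ s → s < 1 → 0 < γ → γ ≤ 1 →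
      ∀ (V : Type*) [Finite V] (pos : V → ℝ),
        (∀ u v : V, u ≠ v → γ ≤ |pos u - pos v|) →
        (Highway.swampGraph s pos).Connected →
      ∀ (M : Type*) (src : V) (m : M),
        -- Procedure `D*` takes `Θ(g²)` rounds, where `g = 1 / γ`
        c * (1 / γ) ^ 2 ≤ (Highway.dStarRounds s γ : ℝ) ∧
        (Highway.dStarRounds s γ : ℝ) ≤ C * (1 / γ) ^ 2 ∧
        -- and after it each node knows exactly the other nodes within distance `1`
        (∀ u : V, Highway.knownLabels s γ (pos u)
            (Highway.history (Highway.algorithmB M) s γ pos (Highway.sourceInput src m)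
              (Highway.dStarRounds s γ) u) =
          {a | ∃ v : V, v ≠ u ∧ |pos u - pos v| ≤ 1 ∧ Highway.label s γ (pos v) = a}) ∧
        -- Procedure `T` then informs all nodes within `O(D / l)` rounds,
        -- and Algorithm `B` takes `O(D / l + g²)` rounds altogether
        ∃ T : ℕ,
          (T : ℝ) ≤ C * ((Highway.swampGraph s pos).diam / max (1 - s) γ) ∧
          ((Highway.dStarRounds s γ + T : ℕ) : ℝ) ≤
            C * ((Highway.swampGraph s pos).diam / max (1 - s) γ + (1 / γ) ^ 2) ∧
          ∀ u : V, Highway.Informed (Highway.algorithmB M) s γ pos src m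
            (Highway.dStarRounds s γ + T) u := by
  obtain ⟨c, C, hc, hC, h⟩ := theorem2_general
  refine ⟨c, C, hc, hC, fun s γ hs _ hγ hγ1 V _ pos hsep hconn M src m => ?_⟩
  obtain ⟨hlow, hup, hknown, hbroadcast⟩ := h s γ hs hγ hγ1 V pos hsep hconn M src m
  obtain ⟨T, hT, hBT, hinformed⟩ := hbroadcast (Highway.swampGraph s pos).diam
  have := hconn.nonempty
  exact ⟨hlow, hup, hknown, T, hT, hBT, fun u => hinformed u <|
    SimpleGraph.dist_le_diam (SimpleGraph.connected_iff_ediam_ne_top.1 hconn)⟩
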